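/- Conventions. A weighted directed graph on $N$ vertices is identified with its adjacency matrix $A\in\mathbb R^{N\times N}$, where $A_{ba}$ is the weight of the edge $e_{ab}$ from $a$ to $b$, and $A_{ba}=0$ means that there is no such edge; a loop counts as an outgoing edge. Minimal specialization. Let $i\neq j$ be vertices such that $i$ has at least two outgoing edges and $w=A_{ji}\ne 0$. The minimal specialization $\overline A\in\mathbb R^{(N+1)\times(N+1)}$ of $A$ over $i$ with edge $e_{ij}$ has one additional vertex $\overline i$ and the entries $$\overline A_{j\overline i}=1,\qquad \overline A_{b\overline i}=0\ (b\ne j),$$ $$\overline A_{\overline i i}=\tfrac{w}{1-w}A_{ii},\qquad \overline A_{\overline i a}=wA_{ia}\ (a\ne i,\overline i),$$ $$\overline A_{ji}=0,\qquad \overline A_{ii}=A_{ii},\qquad \overline A_{bi}=\tfrac{1}{1-w}A_{bi}\ (b\ne i,j,\overline i),$$ $$\overline A_{ia}=(1-w)A_{ia}\ (a\ne i,\overline i),\qquad \overline A_{ba}=A_{ba}\ (a,b\notin\{i,\overline i\}).$$ Eigenvector centrality. The eigenvector centrality of $A$ is the entrywise positive vector $v$ with $Av=\rho(A)v$ and $\|v\|_1=1$,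 where $\rho(A)$ is the spectral radius. (For a primitive column-stochastic matrix this is the stationary distribution, whose entries are the asymptotic loads of the vertices.) Integrated specialization model. Fix $d\ge 2$ and call a vertex eligible if it has at least $d$ outgoing edges. Let $A_0\in[0,1]^{n\times n}$ be column stochastic and irreducible (for example primitive). Let $(A_m)_{m\ge0}$ be a sequence of matrices such that, for every $m\ge 0$, $A_{m+1}$ is the minimal specialization of $A_m$ over a vertex $i_m$ with edge $e_{i_mj_m}$, $j_m\ne i_m$, where $i_m$ is eligible and has maximal eigenvector centrality in $A_m$ among the eligible vertices, and $e_{i_mj_m}$ has maximal weight among the edges from $i_m$ to other vertices; ties are broken arbitrarily. Thus $A_m$ is of size $(n+m)\times(n+m)$. Theorem. Every $A_m$ has exactly one eigenvector centrality $v^{(m)}\in\mathbb R^{n+m}$. With $i=i_m$, $j=j_m$, $w_m=(A_m)_{j_mi_m}$, and $\overline i$ the vertex added in step $m$, for every $m\ge0$, $$v^{(m+1)}_\ell=\begin{cases}(1-w_m)\,v^{(m)}_{i}&\text{if }\ell=i,\\ w_m\,v^{(m)}_{i}&\text{if }\ell=\overline i,\\ v^{(m)}_\ell&\text{otherwise,}\end{cases}$$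 and consequently $$\max_{1\le k\le n+m}v^{(m)}_k\ \ge\ \max_{1\le k\le n+m+1}v^{(m+1)}_k .$$ -/

import Mathlib

/-!
A weighted directed graph on the vertices `Fin N` is identified with its adjacency matrix `A`,
where `A b a` is the weight of the edge from `a` to `b`, and `A b a = 0` when there is no such edge.
-/

/-- There is an edge from `a` to `b` in the graph of `A`. -/
def HasEdge {N : ℕ} (A : Matrix (Fin N) (Fin N) ℝ) (a b : Fin N) : Prop := A b a ≠ 0

/-- The number of outgoing edges of `a` (a loop at `a` counts as one of them). -/
noncomputable def outDegree {N : ℕ} (A : Matrix (Fin N) (Fin N) ℝ) (a : Fin N) : ℕ :=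
  Set.ncard {b : Fin N | HasEdge A a b}

/-- The minimal specialization of the graph of `A` over the vertex `i` with the edge from `i` to
`j`, as an adjacency matrix on `Fin (N + 1)`. With `w` the weight of the edge from `i` to `j`, the
old vertices are `Fin.castSucc a`, the new copy of `i` is `Fin.last N`, and the entry in row `β` and
column `α` is the new weight of the edge from `α` to `β`. -/
noncomputable def minimalSpecialization {N : ℕ} (A : Matrix (Fin N) (Fin N) ℝ) (i j : Fin N) :
    Matrix (Fin (N + 1)) (Fin (N + 1)) ℝ :=
  Matrix.of fun β α =>
    let w := A j i
    Fin.lastCases (motive := fun _ => ℝ)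
      -- edges out of the copy of `i`: only the one to `j`
      (if β = j.castSucc then 1 else 0)
      (fun a =>
        Fin.lastCases (motive := fun _ => ℝ)
          -- edges from an old vertex `a` to the copy of `i`
          (if a = i then w * (1 - w)⁻¹ * A i i else w * A i a)
          -- edges from an old vertex `a` to an old vertex `b`
          (fun b =>
            if a = i then
              if b = j then 0
              else if b = i then A i i
              else (1 - w)⁻¹ * A b i
            else if b = i then (1 - w) * A i a
            else A b a)
          β)
      α

/-- The spectral radius of a real square matrix: the largest modulus of its complex eigenvalues. -/
noncomputable def matrixSpectralRadius {N : ℕ} (A : Matrix (Fin N) (Fin N) ℝ) : ℝ :=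
  (spectralRadius ℂ (A.map (algebraMap ℝ ℂ))).toReal

/-- `v` is the eigenvector centrality of `A`: the positive leading eigenvector, that is, the
positive eigenvector for the spectral radius, scaled to have 1-norm one. -/
structure IsEigenvectorCentrality {N : ℕ} (A : Matrix (Fin N) (Fin N) ℝ) (v : Fin N → ℝ) :
    Prop where
  eigen : A.mulVec v = matrixSpectralRadius A • v
  pos : ∀ k, 0 < v k
  norm_one : ∑ k, |v k| = 1

/-- `A'` is a minimal dynamic specialization of `A`: the minimal specialization over a vertex `i`
of maximal eigenvector centrality among the vertices with at least `d` outgoing edges, with an edge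
from `i` to some `j ≠ i` of maximal weight among the edges from `i` to other vertices.
Ties are broken arbitrarily. -/
structure IsMinimalDynamicSpecialization (d : ℕ) {N : ℕ} (A : Matrix (Fin N) (Fin N) ℝ)
    (i j : Fin N) (A' : Matrix (Fin (N + 1)) (Fin (N + 1)) ℝ) : Prop where
  ne : j ≠ i
  edge : HasEdge A i j
  eligible : d ≤ outDegree A i
  max_load : ∀ v, IsEigenvectorCentrality A v → ∀ k, d ≤ outDegree A k → v k ≤ v i
  max_weight : ∀ l, l ≠ i → HasEdge A i l → A l i ≤ A j i
  eq_specialization : A' = minimalSpecialization A i j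

/-! A column stochastic matrix has spectral radius 1, so its eigenvector centralities are its
positive fixed vectors of sum 1. Let w = A_ji, which lies in (0,1). Specialization keeps the matrix
column stochastic, and its row at the new vertex is w/(1-w) times its row at i. Every fixed vector
therefore has entries at i and its copy in the ratio (1-w) : w and arises by splitting some v; it is
fixed exactly when A fixes v, since the flow w v_i from i to j now passes through the copy.

So splitting carries the centralities of A onto those of the specialization
(`isEigenvectorCentrality_minimalSpecialization_iff`). Irreducibility gives existence and uniqueness
for A_0 (`existsUnique_pos_fixed`), and both propagate by induction. Splitting never raises a value,
whence the inequality of maxima. -/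

open Matrix

/-! ### Perron–Frobenius facts for column stochastic matrices -/

section Stochastic

variable {ι : Type*} [Fintype ι] [DecidableEq ι] {A : Matrix ι ι ℝ}

/-- A column stochastic matrix does not decrease the absolute value of a fixed vector, and it
preserves its sum, so it fixes the absolute value. -/
lemma abs_fixed_of_mem_colStochastic (hA : A ∈ colStochastic ℝ ι) {x : ι → ℝ} (hx : A *ᵥ x = x) :
    A *ᵥ (fun k => |x k|) = fun k => |x k| := by
  have hle : ∀ k ∈ Finset.univ, |x k| ≤ (A *ᵥ fun k => |x k|) k := by
    intro k _
    calc |x k| = |∑ l, A k l * x l| := by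
          conv_lhs => rw [← congrFun hx k]
          rfl
      _ ≤ ∑ l, |A k l * x l| := Finset.abs_sum_le_sum_abs _ _
      _ = (A *ᵥ fun k => |x k|) k := by
          simp [mulVec, dotProduct, abs_mul, abs_of_nonneg (nonneg_of_mem_colStochastic hA)]
  have h := (Finset.sum_eq_sum_iff_of_le hle).1 (sum_mulVec_of_mem_colStochastic hA).symm
  exact funext fun k => (h k (Finset.mem_univ k)).symm

lemma pow_mulVec_fixed {x : ι → ℝ} (hx : A *ᵥ x = x) (m : ℕ) : (A ^ m) *ᵥ x = x := by
  induction m with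
  | zero => simp
  | succ m ih => rw [pow_succ, ← mulVec_mulVec, hx, ih]

/-- A nonnegative nonzero fixed vector of an irreducible matrix is positive. -/
lemma pos_of_fixed_of_isIrreducible (hA : A.IsIrreducible) {x : ι → ℝ} (hx : A *ᵥ x = x)
    (hx0 : ∀ k, 0 ≤ x k) {l : ι} (hl : x l ≠ 0) (k : ι) : 0 < x k := by
  obtain ⟨m, -, hm⟩ := (isIrreducible_iff_exists_pow_pos hA.nonneg).1 hA k l
  rw [← congrFun (pow_mulVec_fixed hx m) k]
  exact Finset.sum_pos' (fun a _ => mul_nonneg (pow_apply_nonneg hA.nonneg m k a) (hx0 a))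
    ⟨l, Finset.mem_univ l, mul_pos hm ((hx0 l).lt_of_ne' hl)⟩

/-- The all-ones row vector is a left null vector of `A - 1`, so `A - 1` is singular and has a right
null vector too. -/
lemma exists_fixed_of_mem_colStochastic [Nonempty ι] (hA : A ∈ colStochastic ℝ ι) :
    ∃ x, x ≠ 0 ∧ A *ᵥ x = x := by
  have hdet : (A - 1).det = 0 := by
    refine exists_vecMul_eq_zero_iff.1 ⟨1, one_ne_zero, ?_⟩
    rw [vecMul_sub, one_vecMul_of_mem_colStochastic hA, vecMul_one, sub_self]
  obtain ⟨x, hx, h⟩ := exists_mulVec_eq_zero_iff.2 hdet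
  exact ⟨x, hx, by rwa [sub_mulVec, one_mulVec, sub_eq_zero] at h⟩

/-- An irreducible column stochastic matrix has exactly one positive fixed vector with sum one. -/
lemma existsUnique_pos_fixed [Nonempty ι] (hA : A ∈ colStochastic ℝ ι) (hirr : A.IsIrreducible) :
    ∃! v : ι → ℝ, A *ᵥ v = v ∧ (∀ k, 0 < v k) ∧ ∑ k, v k = 1 := by
  obtain ⟨x, hx, hfix⟩ := exists_fixed_of_mem_colStochastic hA
  obtain ⟨l, hl⟩ := Function.ne_iff.1 hx
  have hpos : ∀ k, 0 < |x k| := pos_of_fixed_of_isIrreducible hirr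
    (abs_fixed_of_mem_colStochastic hA hfix) (fun k => abs_nonneg _) (abs_ne_zero.2 hl)
  have hsum : 0 < ∑ k, |x k| := Finset.sum_pos (fun k _ => hpos k) Finset.univ_nonempty
  have huniq : ∀ u v : ι → ℝ, (A *ᵥ u = u ∧ (∀ k, 0 < u k) ∧ ∑ k, u k = 1) →
      (A *ᵥ v = v ∧ (∀ k, 0 < v k) ∧ ∑ k, v k = 1) → ∀ k, u k ≤ v k := by
    rintro u v ⟨hu, -, hu1⟩ ⟨hv, -, hv1⟩ k
    by_contra! hk
    have hy : A *ᵥ (u - v) = u - v := by rw [mulVec_sub, hu, hv]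
    -- Twice the positive part of `u - v` is fixed and nonzero at `k`, hence positive everywhere; so
    -- `u > v` in every entry, against the equal sums.
    have hz : A *ᵥ (fun k => |(u - v) k| + (u - v) k) = fun k => |(u - v) k| + (u - v) k := by
      have := mulVec_add A (fun k => |(u - v) k|) (u - v)
      rw [abs_fixed_of_mem_colStochastic hA hy, hy] at this
      exact this
    have hz0 : |(u - v) k| + (u - v) k ≠ 0 :=
      (add_pos_of_nonneg_of_pos (abs_nonneg _) (sub_pos.2 hk)).ne'
    have hzpos := pos_of_fixed_of_isIrreducible hirr hz (fun k => by
      linarith [neg_abs_le ((u - v) k)]) hz0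
    have : ∑ k, v k < ∑ k, u k := by
      refine Finset.sum_lt_sum_of_nonempty Finset.univ_nonempty fun a _ => ?_
      by_contra! ha
      have := hzpos a
      rw [Pi.sub_apply, abs_of_nonpos (sub_nonpos.2 ha)] at this
      linarith
    linarith
  have hv : A *ᵥ (fun k => (∑ k, |x k|)⁻¹ * |x k|) = (fun k => (∑ k, |x k|)⁻¹ * |x k|) ∧
      (∀ k, 0 < (∑ k, |x k|)⁻¹ * |x k|) ∧ ∑ k, (∑ k, |x k|)⁻¹ * |x k| = 1 := by
    refine ⟨?_, fun k => mul_pos (inv_pos.2 hsum) (hpos k), ?_⟩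
    · have := mulVec_smul A (∑ k, |x k|)⁻¹ (fun k => |x k|)
      rw [abs_fixed_of_mem_colStochastic hA hfix] at this
      exact this
    · rw [← Finset.mul_sum, inv_mul_cancel₀ hsum.ne']
  exact ⟨_, hv, fun u hu => funext fun k => le_antisymm (huniq _ _ hu hv k) (huniq _ _ hv hu k)⟩

/-- The spectral radius of a column stochastic matrix is one. -/
lemma spectralRadius_of_mem_colStochastic [Nonempty ι] (hA : A ∈ colStochastic ℝ ι) :
    spectralRadius ℂ (A.map (algebraMap ℝ ℂ)) = 1 := by
  -- Left eigenvectors are the convenient ones: column sums of one bound `‖μ‖` at an entry of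
  -- maximal modulus, and the all-ones vector realizes `1`.
  have hmem : ∀ μ : ℂ, μ ∈ spectrum ℂ (A.map (algebraMap ℝ ℂ)) ↔
      ∃ x, x ≠ 0 ∧ x ᵥ* A.map (algebraMap ℝ ℂ) = μ • x := by
    intro μ
    rw [spectrum.mem_iff, isUnit_iff_isUnit_det, isUnit_iff_ne_zero, not_not,
      ← exists_vecMul_eq_zero_iff]
    refine exists_congr fun x => and_congr_right fun _ => ?_
    rw [vecMul_sub, sub_eq_zero, Algebra.algebraMap_eq_smul_one, vecMul_smul, vecMul_one, eq_comm]
  apply le_antisymm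
  · refine iSup₂_le fun μ hμ => ?_
    obtain ⟨x, hx, h⟩ := (hmem μ).1 hμ
    obtain ⟨k, -, hk⟩ := Finset.exists_max_image Finset.univ (fun k => ‖x k‖) Finset.univ_nonempty
    have hkpos : 0 < ‖x k‖ := by
      obtain ⟨l, hl⟩ := Function.ne_iff.1 hx
      exact (norm_pos_iff.2 hl).trans_le (hk l (Finset.mem_univ l))
    have hle : ‖μ‖ * ‖x k‖ ≤ 1 * ‖x k‖ := calc
      ‖μ‖ * ‖x k‖ = ‖∑ l, x l * (A l k : ℂ)‖ := by
        rw [← norm_mul, ← smul_eq_mul, ← Pi.smul_apply, ← h]; rfl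
      _ ≤ ∑ l, ‖x l * (A l k : ℂ)‖ := norm_sum_le _ _
      _ ≤ ∑ l, A l k * ‖x k‖ := Finset.sum_le_sum fun l _ => by
        rw [norm_mul, Complex.norm_real, Real.norm_of_nonneg (nonneg_of_mem_colStochastic hA),
          mul_comm]
        exact mul_le_mul_of_nonneg_left (hk l (Finset.mem_univ l)) (nonneg_of_mem_colStochastic hA)
      _ = 1 * ‖x k‖ := by rw [← Finset.sum_mul, sum_col_of_mem_colStochastic hA]
    have := le_of_mul_le_mul_right hle hkpos
    exact_mod_cast (show ‖μ‖₊ ≤ 1 from this)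
  · have h1 : (1 : ℂ) ∈ spectrum ℂ (A.map (algebraMap ℝ ℂ)) := by
      refine (hmem 1).2 ⟨1, one_ne_zero, funext fun k => ?_⟩
      have := sum_col_of_mem_colStochastic hA k
      simpa [vecMul, dotProduct] using congrArg (algebraMap ℝ ℂ) this
    simpa [spectralRadius] using le_iSup₂ (f := fun (k : ℂ) (_ : k ∈ spectrum ℂ (A.map (algebraMap ℝ ℂ))) =>
      (‖k‖₊ : ENNReal)) 1 h1

end Stochastic

/-! ### Centrality as a normalized positive fixed vector -/

section Centrality

variable {N : ℕ} {A : Matrix (Fin N) (Fin N) ℝ}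

lemma isEigenvectorCentrality_iff [Nonempty (Fin N)] (hA : A ∈ colStochastic ℝ (Fin N))
    (v : Fin N → ℝ) :
    IsEigenvectorCentrality A v ↔ A *ᵥ v = v ∧ (∀ k, 0 < v k) ∧ ∑ k, v k = 1 := by
  have hρ : matrixSpectralRadius A = 1 := by
    rw [matrixSpectralRadius, spectralRadius_of_mem_colStochastic hA, ENNReal.toReal_one]
  constructor
  · rintro ⟨h, hpos, hsum⟩
    rw [hρ, one_smul] at h
    exact ⟨h, hpos, by simpa [abs_of_pos (hpos _)] using hsum⟩
  · rintro ⟨h, hpos, hsum⟩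
    exact ⟨by rw [hρ, one_smul, h], hpos, by simpa [abs_of_pos (hpos _)] using hsum⟩

/-- A vertex of out-degree at least two has no outgoing edge of weight one. -/
lemma lt_one_of_two_le_outDegree (hA : A ∈ colStochastic ℝ (Fin N)) {i j : Fin N}
    (h : 2 ≤ outDegree A i) : A j i < 1 := by
  obtain ⟨b, hb, hbj⟩ := Set.exists_ne_of_one_lt_ncard h j
  have hpos : 0 < A b i := (nonneg_of_mem_colStochastic hA).lt_of_ne' hb
  have := Finset.add_le_sum (s := Finset.univ) (f := fun k => A k i)
    (fun k _ => nonneg_of_mem_colStochastic hA) (Finset.mem_univ j) (Finset.mem_univ b) hbj.symm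
  rw [sum_col_of_mem_colStochastic hA] at this
  linarith

end Centrality

/-! ### Fixed vectors of a minimal specialization -/

section Specialization

variable {N : ℕ} {A : Matrix (Fin N) (Fin N) ℝ} {i j : Fin N}

/-- The vector on the specialized graph that distributes the value of `v` at `i` between `i` and
its copy in the proportion `(1 - w) : w`. -/
noncomputable def splitVector (w : ℝ) (i : Fin N) (v : Fin N → ℝ) : Fin (N + 1) → ℝ :=
  Fin.snoc (α := fun _ => ℝ) (Function.update v i ((1 - w) * v i)) (w * v i)

lemma splitVector_last (w : ℝ) (i : Fin N) (v : Fin N → ℝ) :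
    splitVector w i v (Fin.last N) = w * v i := by
  simp [splitVector]

lemma splitVector_castSucc_self (w : ℝ) (i : Fin N) (v : Fin N → ℝ) :
    splitVector w i v i.castSucc = (1 - w) * v i := by
  simp [splitVector]

lemma splitVector_castSucc_of_ne (w : ℝ) (v : Fin N → ℝ) {l : Fin N} (h : l ≠ i) :
    splitVector w i v l.castSucc = v l := by
  simp [splitVector, h]

lemma sum_splitVector (w : ℝ) (i : Fin N) (v : Fin N → ℝ) :
    ∑ k, splitVector w i v k = ∑ k, v k := by
  rw [Fin.sum_univ_castSucc, ← Finset.add_sum_erase _ _ (Finset.mem_univ i),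
    ← Finset.add_sum_erase _ v (Finset.mem_univ i), splitVector_last, splitVector_castSucc_self,
    Finset.sum_congr rfl fun l hl =>
      splitVector_castSucc_of_ne w v (Finset.ne_of_mem_erase hl)]
  ring

lemma mulVec_apply_eq_add_sum_erase (A : Matrix (Fin N) (Fin N) ℝ) (i : Fin N) (v : Fin N → ℝ)
    (b : Fin N) : (A *ᵥ v) b = A b i * v i + ∑ a ∈ Finset.univ.erase i, A b a * v a :=
  (Finset.add_sum_erase _ (fun a => A b a * v a) (Finset.mem_univ i)).symm

/-- This is `w / (1 - w)` times the value at `i.castSucc` when `j ≠ i` and `w = A j i ≠ 1`. -/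
lemma minimalSpecialization_mulVec_last (u : Fin (N + 1) → ℝ) :
    (minimalSpecialization A i j *ᵥ u) (Fin.last N) =
      A j i * (1 - A j i)⁻¹ * A i i * u i.castSucc +
        A j i * ∑ a ∈ Finset.univ.erase i, A i a * u a.castSucc := by
  rw [mulVec, dotProduct, Fin.sum_univ_castSucc, ← Finset.add_sum_erase _ _ (Finset.mem_univ i),
    Finset.mul_sum]
  rw [Finset.sum_congr rfl fun a ha => show _ = A j i * (A i a * u a.castSucc) by
    simp [minimalSpecialization, Finset.ne_of_mem_erase ha, mul_assoc]]
  simp [minimalSpecialization, (Fin.castSucc_lt_last j).ne']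

lemma minimalSpecialization_mulVec_castSucc_self (hij : j ≠ i) (u : Fin (N + 1) → ℝ) :
    (minimalSpecialization A i j *ᵥ u) i.castSucc =
      A i i * u i.castSucc +
        (1 - A j i) * ∑ a ∈ Finset.univ.erase i, A i a * u a.castSucc := by
  rw [mulVec, dotProduct, Fin.sum_univ_castSucc, ← Finset.add_sum_erase _ _ (Finset.mem_univ i),
    Finset.mul_sum]
  rw [Finset.sum_congr rfl fun a ha => show _ = (1 - A j i) * (A i a * u a.castSucc) by
    simp [minimalSpecialization, Finset.ne_of_mem_erase ha, mul_assoc]]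
  simp [minimalSpecialization, hij.symm]

lemma minimalSpecialization_mulVec_castSucc_of_ne (u : Fin (N + 1) → ℝ) {b : Fin N}
    (hb : b ≠ i) :
    (minimalSpecialization A i j *ᵥ u) b.castSucc =
      (if b = j then u (Fin.last N) else (1 - A j i)⁻¹ * A b i * u i.castSucc) +
        ∑ a ∈ Finset.univ.erase i, A b a * u a.castSucc := by
  rw [mulVec, dotProduct, Fin.sum_univ_castSucc, ← Finset.add_sum_erase _ _ (Finset.mem_univ i)]
  rw [Finset.sum_congr rfl fun a ha => show _ = A b a * u a.castSucc by
    simp [minimalSpecialization, Finset.ne_of_mem_erase ha, hb]]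
  by_cases h : b = j
  · simp [minimalSpecialization, h, add_comm]
  · simp [minimalSpecialization, h, hb]

lemma minimalSpecialization_nonneg (hA : A ∈ colStochastic ℝ (Fin N)) (hw : A j i < 1)
    (β α : Fin (N + 1)) : 0 ≤ minimalSpecialization A i j β α := by
  have h : ∀ {a b}, 0 ≤ A a b := nonneg_of_mem_colStochastic hA
  have hw' : 0 ≤ 1 - A j i := (sub_pos.2 hw).le
  have hw'' : 0 ≤ (1 - A j i)⁻¹ := inv_nonneg.2 hw'
  cases α using Fin.lastCases with
  | last => simp only [minimalSpecialization, of_apply, Fin.lastCases_last]; split_ifs <;> norm_num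
  | cast a =>
    cases β using Fin.lastCases with
    | last =>
      simp only [minimalSpecialization, of_apply, Fin.lastCases_last, Fin.lastCases_castSucc]
      split_ifs
      · exact mul_nonneg (mul_nonneg h hw'') h
      · exact mul_nonneg h h
    | cast b =>
      simp only [minimalSpecialization, of_apply, Fin.lastCases_castSucc]
      split_ifs
      · exact le_rfl
      · exact h
      · exact mul_nonneg hw'' h
      · exact mul_nonneg hw' h
      · exact h

/-- In column `i` the two multiples of `A i i` add up to `A i i / (1 - w)`, which makes up for the
deleted entry `w`; in the other old columns `A i a` is merely split in two. -/
lemma minimalSpecialization_mem_colStochastic (hA : A ∈ colStochastic ℝ (Fin N)) (hij : j ≠ i)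
    (hw : A j i < 1) : minimalSpecialization A i j ∈ colStochastic ℝ (Fin (N + 1)) := by
  refine mem_colStochastic_iff_sum.2 ⟨minimalSpecialization_nonneg hA hw, fun α => ?_⟩
  have hw' : 1 - A j i ≠ 0 := (sub_pos.2 hw).ne'
  rw [Fin.sum_univ_castSucc]
  cases α using Fin.lastCases with
  | last => simp [minimalSpecialization, (Fin.castSucc_lt_last j).ne']
  | cast a =>
    have hcol := sum_col_of_mem_colStochastic hA a
    rw [← Finset.add_sum_erase _ _ (Finset.mem_univ i)] at hcol ⊢
    by_cases ha : a = i
    · subst ha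
      have hj : j ∈ Finset.univ.erase a := Finset.mem_erase.2 ⟨hij, Finset.mem_univ j⟩
      rw [← Finset.add_sum_erase _ _ hj] at hcol ⊢
      rw [Finset.sum_congr rfl fun b hb => show _ = (1 - A j a)⁻¹ * A b a by
        simp [minimalSpecialization, Finset.ne_of_mem_erase hb,
          Finset.ne_of_mem_erase (Finset.mem_of_mem_erase hb)], ← Finset.mul_sum]
      rw [show ∑ b ∈ (Finset.univ.erase a).erase j, A b a = 1 - A j a - A a a by linarith]
      simp only [minimalSpecialization, of_apply, Fin.lastCases_last, Fin.lastCases_castSucc,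
        if_true, hij.symm, if_false]
      field_simp
      ring
    · rw [Finset.sum_congr rfl fun b hb => show _ = A b a by
        simp [minimalSpecialization, Finset.ne_of_mem_erase hb, ha]]
      simp only [minimalSpecialization, of_apply, Fin.lastCases_last, Fin.lastCases_castSucc,
        if_true, ha, if_false]
      linarith

lemma sum_erase_splitVector (w : ℝ) (v : Fin N → ℝ) (b : Fin N) :
    ∑ a ∈ Finset.univ.erase i, A b a * splitVector w i v a.castSucc =
      ∑ a ∈ Finset.univ.erase i, A b a * v a :=
  Finset.sum_congr rfl fun a ha => by
    rw [splitVector_castSucc_of_ne w v (Finset.ne_of_mem_erase ha)]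

/-- Splitting a fixed vector gives a fixed vector of the specialization, and conversely. -/
lemma minimalSpecialization_mulVec_splitVector_iff (hij : j ≠ i) (hw : A j i < 1)
    (v : Fin N → ℝ) :
    minimalSpecialization A i j *ᵥ splitVector (A j i) i v = splitVector (A j i) i v ↔
      A *ᵥ v = v := by
  have hw' : 1 - A j i ≠ 0 := (sub_pos.2 hw).ne'
  have hself : (minimalSpecialization A i j *ᵥ splitVector (A j i) i v) i.castSucc =
      (1 - A j i) * (A *ᵥ v) i := by
    rw [minimalSpecialization_mulVec_castSucc_self hij, sum_erase_splitVector,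
      splitVector_castSucc_self, mulVec_apply_eq_add_sum_erase A i]
    ring
  have hlast : (minimalSpecialization A i j *ᵥ splitVector (A j i) i v) (Fin.last N) =
      A j i * (A *ᵥ v) i := by
    rw [minimalSpecialization_mulVec_last, sum_erase_splitVector,
      splitVector_castSucc_self, mulVec_apply_eq_add_sum_erase A i]
    field_simp
  have hne : ∀ b ≠ i, (minimalSpecialization A i j *ᵥ splitVector (A j i) i v) b.castSucc =
      (A *ᵥ v) b := by
    intro b hb
    rw [minimalSpecialization_mulVec_castSucc_of_ne _ hb, sum_erase_splitVector,
      splitVector_castSucc_self, splitVector_last, mulVec_apply_eq_add_sum_erase A i]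
    split_ifs with h
    · rw [h]
    · field_simp
  constructor
  · intro h
    funext b
    by_cases hb : b = i
    · subst hb
      rw [h, splitVector_castSucc_self] at hself
      exact (mul_left_cancel₀ hw' hself).symm
    · rw [← hne b hb, h, splitVector_castSucc_of_ne _ _ hb]
  · intro h
    funext β
    cases β using Fin.lastCases with
    | last => rw [hlast, h, splitVector_last]
    | cast b =>
      by_cases hb : b = i
      · rw [hb, hself, h, splitVector_castSucc_self]
      · rw [hne b hb, h, splitVector_castSucc_of_ne _ _ hb]

/-- Every fixed vector of the specialization arises by splitting. -/
lemma eq_splitVector_of_minimalSpecialization_mulVec (hij : j ≠ i) (hw : A j i < 1)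
    {u : Fin (N + 1) → ℝ} (hu : minimalSpecialization A i j *ᵥ u = u) :
    ∃ v, u = splitVector (A j i) i v := by
  have hw' : 1 - A j i ≠ 0 := (sub_pos.2 hw).ne'
  have h1 := congrFun hu i.castSucc
  have h2 := congrFun hu (Fin.last N)
  rw [minimalSpecialization_mulVec_castSucc_self hij] at h1
  rw [minimalSpecialization_mulVec_last] at h2
  -- The proportional rows force the ratio of the entries of a fixed vector at `i` and at its copy.
  have hlast : (1 - A j i) * u (Fin.last N) = A j i * u i.castSucc := by
    rw [← h2, ← mul_right_inj' hw']
    field_simp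
    linear_combination A j i * h1
  -- Splitting is undone by adding the value at the copy back to the value at `i`.
  refine ⟨Function.update (fun k => u k.castSucc) i (u i.castSucc + u (Fin.last N)), ?_⟩
  funext β
  cases β using Fin.lastCases with
  | last =>
    rw [splitVector_last, Function.update_self]
    linarith
  | cast b =>
    by_cases hb : b = i
    · rw [hb, splitVector_castSucc_self, Function.update_self]
      linarith
    · rw [splitVector_castSucc_of_ne _ _ hb, Function.update_of_ne hb]

lemma splitVector_pos_iff {w : ℝ} (h0 : 0 < w) (h1 : w < 1) (v : Fin N → ℝ) :
    (∀ k, 0 < splitVector w i v k) ↔ ∀ k, 0 < v k := by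
  have hw' : 0 < 1 - w := sub_pos.2 h1
  constructor
  · intro h k
    by_cases hk : k = i
    · have := h (Fin.last N)
      rw [splitVector_last] at this
      rw [hk]
      exact pos_of_mul_pos_right this h0.le
    · simpa [splitVector_castSucc_of_ne w v hk] using h k.castSucc
  · intro h β
    cases β using Fin.lastCases with
    | last => rw [splitVector_last]; exact mul_pos h0 (h i)
    | cast b =>
      by_cases hb : b = i
      · rw [hb, splitVector_castSucc_self]; exact mul_pos hw' (h i)
      · rw [splitVector_castSucc_of_ne w v hb]; exact h b

/-- Both directions are needed: uniqueness then passes to the specialization without proving it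
irreducible. -/
lemma isEigenvectorCentrality_minimalSpecialization_iff [Nonempty (Fin N)]
    (hA : A ∈ colStochastic ℝ (Fin N)) (hij : j ≠ i) (h0 : 0 < A j i) (h1 : A j i < 1)
    (u : Fin (N + 1) → ℝ) :
    IsEigenvectorCentrality (minimalSpecialization A i j) u ↔
      ∃ v, IsEigenvectorCentrality A v ∧ u = splitVector (A j i) i v := by
  have key : ∀ v, IsEigenvectorCentrality (minimalSpecialization A i j) (splitVector (A j i) i v) ↔
      IsEigenvectorCentrality A v := fun v => by
    rw [isEigenvectorCentrality_iff hA,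
      isEigenvectorCentrality_iff (minimalSpecialization_mem_colStochastic hA hij h1),
      minimalSpecialization_mulVec_splitVector_iff hij h1, splitVector_pos_iff h0 h1,
      sum_splitVector]
  constructor
  · intro hu
    obtain ⟨v, rfl⟩ := eq_splitVector_of_minimalSpecialization_mulVec hij h1
      ((isEigenvectorCentrality_iff (minimalSpecialization_mem_colStochastic hA hij h1) u).1 hu).1
    exact ⟨v, (key v).1 hu, rfl⟩
  · rintro ⟨v, hv, rfl⟩
    exact (key v).2 hv

lemma iSup_splitVector_le [Nonempty (Fin N)] {w : ℝ} (h0 : 0 ≤ w) (h1 : w ≤ 1) {v : Fin N → ℝ}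
    (hv : ∀ k, 0 ≤ v k) : ⨆ k, splitVector w i v k ≤ ⨆ k, v k := by
  have hle : ∀ k, v k ≤ ⨆ k, v k := le_ciSup (Set.finite_range v).bddAbove
  refine ciSup_le fun β => ?_
  cases β using Fin.lastCases with
  | last => rw [splitVector_last]; exact (mul_le_of_le_one_left (hv i) h1).trans (hle i)
  | cast b =>
    by_cases hb : b = i
    · rw [hb, splitVector_castSucc_self]
      exact (mul_le_of_le_one_left (hv i) (by linarith)).trans (hle i)
    · rw [splitVector_castSucc_of_ne w v hb]; exact hle b

end Specialization

theorem mainTheorem6 (n d : ℕ) (hd : 2 ≤ d)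
    (A : (m : ℕ) → Matrix (Fin (n + m)) (Fin (n + m)) ℝ)
    (i j : (m : ℕ) → Fin (n + m))
    (hstoch : A 0 ∈ Matrix.colStochastic ℝ (Fin (n + 0)))
    (hirr : (A 0).IsIrreducible)
    (hstep : ∀ m, IsMinimalDynamicSpecialization d (A m) (i m) (j m) (A (m + 1))) :
    ∃ v : (m : ℕ) → Fin (n + m) → ℝ,
      (∀ m, IsEigenvectorCentrality (A m) (v m) ∧
        ∀ u, IsEigenvectorCentrality (A m) u → u = v m) ∧
      (∀ m,
        v (m + 1) (i m).castSucc = (1 - A m (j m) (i m)) * v m (i m) ∧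
        v (m + 1) (Fin.last (n + m)) = A m (j m) (i m) * v m (i m) ∧
        ∀ l : Fin (n + m), l ≠ i m → v (m + 1) l.castSucc = v m l) ∧
      ∀ m, (⨆ k, v (m + 1) k) ≤ ⨆ k, v m k := by
  have hne : ∀ m, Nonempty (Fin (n + m)) := fun m => ⟨i m⟩
  -- Stochasticity is kept as a premise here because the bound feeds the induction that proves it.
  have hlt : ∀ m, A m ∈ colStochastic ℝ (Fin (n + m)) → A m (j m) (i m) < 1 := fun m h =>
    lt_one_of_two_le_outDegree h (hd.trans (hstep m).eligible)
  have hcol : ∀ m, A m ∈ colStochastic ℝ (Fin (n + m)) := by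
    intro m
    induction m with
    | zero => exact hstoch
    | succ m ih =>
      rw [(hstep m).eq_specialization]
      exact minimalSpecialization_mem_colStochastic ih (hstep m).ne (hlt m ih)
  have hpos : ∀ m, 0 < A m (j m) (i m) := fun m =>
    (nonneg_of_mem_colStochastic (hcol m)).lt_of_ne' (hstep m).edge
  have hiff : ∀ m u, IsEigenvectorCentrality (A (m + 1)) u ↔
      ∃ v, IsEigenvectorCentrality (A m) v ∧ u = splitVector (A m (j m) (i m)) (i m) v := by
    intro m u
    rw [(hstep m).eq_specialization]
    exact isEigenvectorCentrality_minimalSpecialization_iff (hcol m) (hstep m).ne (hpos m)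
      (hlt m (hcol m)) u
  have hex : ∀ m, ∃! v, IsEigenvectorCentrality (A m) v := by
    intro m
    induction m with
    | zero =>
      simp only [isEigenvectorCentrality_iff hstoch]
      exact existsUnique_pos_fixed hstoch hirr
    | succ m ih =>
      obtain ⟨v, hv, huniq⟩ := ih
      refine ⟨_, (hiff m _).2 ⟨v, hv, rfl⟩, fun u hu => ?_⟩
      obtain ⟨v', hv', rfl⟩ := (hiff m u).1 hu
      rw [huniq v' hv']
  choose v hv huniq using hex
  have hsplit : ∀ m, v (m + 1) = splitVector (A m (j m) (i m)) (i m) (v m) := fun m =>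
    (huniq (m + 1) _ ((hiff m _).2 ⟨v m, hv m, rfl⟩)).symm
  refine ⟨v, fun m => ⟨hv m, huniq m⟩, fun m => ?_, fun m => ?_⟩
  · rw [hsplit m]
    exact ⟨splitVector_castSucc_self _ _ _, splitVector_last _ _ _,
      fun l hl => splitVector_castSucc_of_ne _ _ hl⟩
  · rw [hsplit m]
    exact iSup_splitVector_le (hpos m).le (hlt m (hcol m)).le fun k => ((hv m).pos k).le
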